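/- Notation. $\mathfrak S_m$ is the set of permutations $\sigma=\sigma(1)\cdots\sigma(m)$ of $\{1,\dots,m\}$ ($\mathfrak S_0$ consists of the empty permutation), and $\mathfrak S_m(\tau)$ is the set of those that avoid the pattern $\tau\in\mathfrak S_3$. For $\sigma\in\mathfrak S_m$ let $\mathrm{exc}\,\sigma=\#\{i:\sigma(i)>i\}$, $\mathrm{fix}\,\sigma=\#\{i:\sigma(i)=i\}$, $\mathrm{inv}\,\sigma=\#\{(i,j): i<j,\ \sigma(i)>\sigma(j)\}$, $\mathrm{cda}\,\sigma=\#\{x:\sigma^{-1}(x)<x<\sigma(x)\}$ (cyclic double excedances), $\mathrm{des}\,\sigma=\#\{1\le i<m:\sigma(i)>\sigma(i+1)\}$, $\mathrm{asc}\,\sigma=\#\{1\le i<m:\sigma(i)<\sigma(i+1)\}$; let $\mathrm{ldd}\,\sigma=\#\{1\le i\le m:\sigma(i-1)>\sigma(i)>\sigma(i+1)\}$ with the convention $\sigma(0)=0$, $\sigma(m+1)=\infty$, and $\mathrm{rda}\,\sigma=\#\{1\le i\le m:\sigma(i-1)<\sigma(i)<\sigma(i+1)\}$ with the convention $\sigma(0)=\infty$,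 $\sigma(m+1)=0$; and let $(31\text{-}2)\,\sigma=\#\{(i,j):1<j<i\le m,\ \sigma(j)<\sigma(i)<\sigma(j-1)\}$, $(13\text{-}2)\,\sigma=\#\{(i,j):1<j<i\le m,\ \sigma(j-1)<\sigma(i)<\sigma(j)\}$, $(2\text{-}31)\,\sigma=\#\{(i,j):1\le i<j<m,\ \sigma(j+1)<\sigma(i)<\sigma(j)\}$, $(2\text{-}13)\,\sigma=\#\{(i,j):1\le i<j<m,\ \sigma(j)<\sigma(i)<\sigma(j+1)\}$. Define the generalized $q$-Narayana polynomials by $$N_n(t,q,r)=\sum_{\sigma\in\mathfrak S_n(321)}t^{\mathrm{exc}\,\sigma}q^{\mathrm{inv}\,\sigma}r^{\mathrm{fix}\,\sigma},$$ and, for $m,k\ge 0$, the sets $\widetilde{\mathfrak S}_{m,k}(321)=\{\sigma\in\mathfrak S_m(321):\mathrm{exc}\,\sigma=k,\ \mathrm{cda}\,\sigma=0\}$, $\widetilde{\mathfrak S}_{m,k}(\tau)=\{\sigma\in\mathfrak S_m(\tau):\mathrm{des}\,\sigma=k,\ \mathrm{ldd}\,\sigma=0\}$ for $\tau\in\{231,312\}$,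 and $\widetilde{\mathfrak S}_{m,k}(\tau)=\{\sigma\in\mathfrak S_m(\tau):\mathrm{asc}\,\sigma=k,\ \mathrm{rda}\,\sigma=0\}$ for $\tau\in\{132,213\}$. Theorem. For $n\ge1$, $$N_n(t/q,q,1)=\sum_{\sigma\in\mathfrak S_n(321)}t^{\mathrm{exc}\,\sigma}q^{\mathrm{inv}\,\sigma-\mathrm{exc}\,\sigma}=\sum_{k=0}^{\lfloor (n-1)/2\rfloor}\gamma_{n-1,k}(q)\,t^k(1+t)^{n-1-2k}$$ (as an identity in $t,q$; equivalently, for all elements $t,q$ of any field with $q\ne0$), where the polynomials $\gamma_{n-1,k}(q)$, $k\ge0$, are given by $$\gamma_{n-1,k}(q)=\sum_{\pi\in\widetilde{\mathfrak S}_{n-1,k}(321)}q^{\mathrm{inv}\,\pi}=\sum_{\pi\in\widetilde{\mathfrak S}_{n-1,k}(231)}q^{(31\text{-}2)\,\pi+\mathrm{des}\,\pi}=\sum_{\pi\in\widetilde{\mathfrak S}_{n-1,k}(312)}q^{(2\text{-}31)\,\pi+\mathrm{des}\,\pi}$$ $$=\sum_{\pi\in\widetilde{\mathfrak S}_{n-1,k}(132)}q^{(2\text{-}13)\,\pi+\mathrm{asc}\,\pi}=\sum_{\pi\in\widetilde{\mathfrak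 S}_{n-1,k}(213)}q^{(13\text{-}2)\,\pi+\mathrm{asc}\,\pi}.$$ -/

import Mathlib

namespace PermStat

open Polynomial

/-! Permutations of `{1, …, n}` are modelled by `Equiv.Perm (Fin n)`, that is with positions and
values shifted down by one. -/

/-- `σ` avoids the pattern `τ = τ 0 τ 1 τ 2`: no subsequence of three letters of the word
`σ(1) ⋯ σ(n)` is order-isomorphic to `τ`. -/
def Avoids {n : ℕ} (σ : Equiv.Perm (Fin n)) (τ : Fin 3 → ℕ) : Prop :=
  ¬ ∃ f : Fin 3 → Fin n, (∀ a b, a < b → f a < f b) ∧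
    ∀ a b, (σ (f a) < σ (f b) ↔ τ a < τ b)

instance {n : ℕ} (σ : Equiv.Perm (Fin n)) (τ : Fin 3 → ℕ) : Decidable (Avoids σ τ) := by
  unfold Avoids; infer_instance

/-- The set `𝔖ₙ(τ)` of permutations of size `n` avoiding `τ`. -/
def avoiders (n : ℕ) (τ : Fin 3 → ℕ) : Finset (Equiv.Perm (Fin n)) :=
  {σ | Avoids σ τ}

variable {n : ℕ} (σ : Equiv.Perm (Fin n))

/-- Number of excedances: indices `i` with `σ(i) > i`. -/
def exc : ℕ := Finset.card {i : Fin n | i < σ i}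

/-- Number of fixed points. -/
def fix : ℕ := Finset.card {i : Fin n | σ i = i}

/-- Number of inversions: pairs `i < j` with `σ(i) > σ(j)`. -/
def inv : ℕ := Finset.card {p : Fin n × Fin n | p.1 < p.2 ∧ σ p.2 < σ p.1}

/-- Number of cyclic double excedances: values `x` with `σ⁻¹(x) < x < σ(x)`. -/
def cda : ℕ := Finset.card {x : Fin n | σ⁻¹ x < x ∧ x < σ x}

/-- Number of descents: `σ(i) > σ(i+1)` (the pair is `(i, i+1)`). -/
def des : ℕ := Finset.card {p : Fin n × Fin n | p.1.val + 1 = p.2.val ∧ σ p.2 < σ p.1}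

/-- Number of ascents: `σ(i) < σ(i+1)` (the pair is `(i, i+1)`). -/
def asc : ℕ := Finset.card {p : Fin n × Fin n | p.1.val + 1 = p.2.val ∧ σ p.1 < σ p.2}

/-- The word `σ(0) σ(1) ⋯ σ(n) σ(n+1)`, indexed from `0`, with letters `1, …, n` at the positions
`1, …, n` and the boundary convention `σ(0) = l`, `σ(n+1) = r`. -/
def padded (l r : ℕ∞) (j : ℕ) : ℕ∞ :=
  if j = 0 then l else if h : j - 1 < n then (((σ ⟨j - 1, h⟩).val + 1 : ℕ) : ℕ∞) else r

/-- Number of double descents for the convention `σ(0) = 0`, `σ(n+1) = ∞`. -/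
def ldd : ℕ := Finset.card {i ∈ Finset.Icc 1 n |
  padded σ 0 ⊤ (i - 1) > padded σ 0 ⊤ i ∧ padded σ 0 ⊤ i > padded σ 0 ⊤ (i + 1)}

/-- Number of double ascents for the convention `σ(0) = ∞`, `σ(n+1) = 0`. -/
def rda : ℕ := Finset.card {i ∈ Finset.Icc 1 n |
  padded σ ⊤ 0 (i - 1) < padded σ ⊤ 0 i ∧ padded σ ⊤ 0 i < padded σ ⊤ 0 (i + 1)}

/-! In the four vincular statistics the triple is `(j, j + 1, i)`. -/

/-- `(31-2)`: pairs with `j + 1 < i` and `σ(j+1) < σ(i) < σ(j)`. -/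
def v31_2 : ℕ := Finset.card {p : Fin n × Fin n × Fin n |
  p.1.val + 1 = p.2.1.val ∧ p.2.1 < p.2.2 ∧ σ p.2.1 < σ p.2.2 ∧ σ p.2.2 < σ p.1}

/-- `(13-2)`: pairs with `j + 1 < i` and `σ(j) < σ(i) < σ(j+1)`. -/
def v13_2 : ℕ := Finset.card {p : Fin n × Fin n × Fin n |
  p.1.val + 1 = p.2.1.val ∧ p.2.1 < p.2.2 ∧ σ p.1 < σ p.2.2 ∧ σ p.2.2 < σ p.2.1}

/-- `(2-31)`: pairs with `i < j` and `σ(j+1) < σ(i) < σ(j)`. -/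
def v2_31 : ℕ := Finset.card {p : Fin n × Fin n × Fin n |
  p.1.val + 1 = p.2.1.val ∧ p.2.2 < p.1 ∧ σ p.2.1 < σ p.2.2 ∧ σ p.2.2 < σ p.1}

/-- `(2-13)`: pairs with `i < j` and `σ(j) < σ(i) < σ(j+1)`. -/
def v2_13 : ℕ := Finset.card {p : Fin n × Fin n × Fin n |
  p.1.val + 1 = p.2.1.val ∧ p.2.2 < p.1 ∧ σ p.1 < σ p.2.2 ∧ σ p.2.2 < σ p.2.1}

/-- The generalized `q`-Narayana polynomial
`Nₙ(t, q, r) = ∑_{σ ∈ 𝔖ₙ(321)} t^exc σ q^inv σ r^fix σ`, evaluated in a commutative semiring. -/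
def qNarayana {R : Type*} [CommSemiring R] (n : ℕ) (t q r : R) : R :=
  ∑ σ ∈ avoiders n ![3, 2, 1], t ^ exc σ * q ^ inv σ * r ^ fix σ

/-- The permutations in `𝔖ₘ(321)` with `exc = k` and `cda = 0`. -/
def tilde321 (m k : ℕ) : Finset (Equiv.Perm (Fin m)) :=
  {π ∈ avoiders m ![3, 2, 1] | exc π = k ∧ cda π = 0}

/-- The permutations in `𝔖ₘ(231)` with `des = k` and `ldd = 0`. -/
def tilde231 (m k : ℕ) : Finset (Equiv.Perm (Fin m)) :=
  {π ∈ avoiders m ![2, 3, 1] | des π = k ∧ ldd π = 0}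

/-- The permutations in `𝔖ₘ(312)` with `des = k` and `ldd = 0`. -/
def tilde312 (m k : ℕ) : Finset (Equiv.Perm (Fin m)) :=
  {π ∈ avoiders m ![3, 1, 2] | des π = k ∧ ldd π = 0}

/-- The permutations in `𝔖ₘ(132)` with `asc = k` and `rda = 0`. -/
def tilde132 (m k : ℕ) : Finset (Equiv.Perm (Fin m)) :=
  {π ∈ avoiders m ![1, 3, 2] | asc π = k ∧ rda π = 0}

/-- The permutations in `𝔖ₘ(213)` with `asc = k` and `rda = 0`. -/
def tilde213 (m k : ℕ) : Finset (Equiv.Perm (Fin m)) :=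
  {π ∈ avoiders m ![2, 1, 3] | asc π = k ∧ rda π = 0}

/-- The polynomial `γ_{m,k}(q) ∈ ℕ[q]`, the inversion generating function of `tilde321 m k`. -/
noncomputable def gammaPoly (m k : ℕ) : ℕ[X] :=
  ∑ π ∈ tilde321 m k, X ^ inv π

end PermStat

namespace PermStat

open Finset

/-! All the sums are transported to pairs `(E, V)` of equinumerous subsets, read as lattice paths:
`E` marks up steps and `V` marks down steps.

A 321-avoiding permutation is increasing on its excedance positions `E` and on their complement, so
it is determined by `E` and the set `V` of excedance values. Its inversion number is `∑ V - ∑ E`.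
The possible pairs are those of `strictPairs`, by `excPair_injOn` and `excPair_surj`. In size `m +
1`, lowering `V` by one gives exactly the pairs of `ballotPairs m` and turns `inv - exc` into `∑ V -
∑ E`. Such a pair is a disjoint pair (a Motzkin path) together with a set `C` of level steps added
to both sides. Each element of `C` contributes a factor `t` and cancels in the exponent of `q`, so a
Motzkin path with `k` up steps contributes `(1 + t) ^ (m - 2k)`. This is `qNarayana_succ`. For
disjoint pairs the weak and strict conditions agree, so the Motzkin paths are also the 321-avoiders
of size `m` with `cda = 0`.

For 231-avoiders without double descents, the pair is formed by the bottoms and tops of descents.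
The arcs joining them form the unique noncrossing matching of the path, and the permutation is
recovered by placing each top directly before its partner. Here `v31_2 + des` is again `∑ V - ∑ E`.
Reversal and complementation give the other three patterns. -/

theorem avoids_iff {n : ℕ} (σ : Equiv.Perm (Fin n)) (τ : Fin 3 → ℕ) :
    Avoids σ τ ↔ ∀ i j k : Fin n, i < j → j < k →
      ¬ ∀ a b, (σ (![i, j, k] a) < σ (![i, j, k] b) ↔ τ a < τ b) := by
  constructor
  · intro h i j k hij hjk hσ
    refine h ⟨![i, j, k], ?_, hσ⟩
    intro a b hab
    fin_cases a <;> fin_cases b <;> simp_all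
    exact hij.trans hjk
  · rintro h ⟨f, hf, hσ⟩
    refine h (f 0) (f 1) (f 2) (hf _ _ (by decide)) (hf _ _ (by decide)) ?_
    have : ![f 0, f 1, f 2] = f := by
      ext a; fin_cases a <;> rfl
    rw [this]
    exact hσ

section patterns

variable {n : ℕ} {σ : Equiv.Perm (Fin n)}

theorem mem_avoiders_321 : σ ∈ avoiders n ![3, 2, 1] ↔
    ∀ i j k, i < j → j < k → σ j < σ i → ¬ σ k < σ j := by
  simp only [avoiders, mem_filter, mem_univ, true_and, avoids_iff]
  refine forall_congr' fun i => forall_congr' fun j => forall_congr' fun k =>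
    imp_congr_right fun _ => imp_congr_right fun _ => ?_
  simp [Fin.forall_fin_succ]
  grind

theorem mem_avoiders_231 : σ ∈ avoiders n ![2, 3, 1] ↔
    ∀ i j k, i < j → j < k → σ k < σ i → ¬ σ i < σ j := by
  simp only [avoiders, mem_filter, mem_univ, true_and, avoids_iff]
  refine forall_congr' fun i => forall_congr' fun j => forall_congr' fun k =>
    imp_congr_right fun _ => imp_congr_right fun _ => ?_
  simp [Fin.forall_fin_succ]
  grind

theorem mem_avoiders_132 : σ ∈ avoiders n ![1, 3, 2] ↔
    ∀ i j k, i < j → j < k → σ i < σ k → ¬ σ k < σ j := by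
  simp only [avoiders, mem_filter, mem_univ, true_and, avoids_iff]
  refine forall_congr' fun i => forall_congr' fun j => forall_congr' fun k =>
    imp_congr_right fun _ => imp_congr_right fun _ => ?_
  simp [Fin.forall_fin_succ]
  grind

theorem mem_avoiders_213 : σ ∈ avoiders n ![2, 1, 3] ↔
    ∀ i j k, i < j → j < k → σ j < σ i → ¬ σ i < σ k := by
  simp only [avoiders, mem_filter, mem_univ, true_and, avoids_iff]
  refine forall_congr' fun i => forall_congr' fun j => forall_congr' fun k =>
    imp_congr_right fun _ => imp_congr_right fun _ => ?_
  simp [Fin.forall_fin_succ]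
  grind

theorem mem_avoiders_312 : σ ∈ avoiders n ![3, 1, 2] ↔
    ∀ i j k, i < j → j < k → σ j < σ k → ¬ σ k < σ i := by
  simp only [avoiders, mem_filter, mem_univ, true_and, avoids_iff]
  refine forall_congr' fun i => forall_congr' fun j => forall_congr' fun k =>
    imp_congr_right fun _ => imp_congr_right fun _ => ?_
  simp [Fin.forall_fin_succ]
  grind

end patterns

/-! ### 321-avoiding permutations encoded by excedance positions and values. -/

/-- The excedance positions. -/
def excPos {n : ℕ} (σ : Equiv.Perm (Fin n)) : Finset (Fin n) := {i | i < σ i}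

/-- The excedance values. -/
def excVal {n : ℕ} (σ : Equiv.Perm (Fin n)) : Finset (Fin n) := {x | σ⁻¹ x < x}

open scoped Classical in
/-- Pairs `(E, V)` that are the excedance positions and values of some permutation. -/
noncomputable def strictPairs (n : ℕ) : Finset (Finset (Fin n) × Finset (Fin n)) :=
  {p | #p.1 = #p.2 ∧ ∀ i : ℕ, #{v ∈ p.2 | v.val ≤ i} ≤ #{e ∈ p.1 | e.val < i}}

/-- Two strictly increasing functions with the same image on `s` agree on `s`. -/
theorem eqOn_of_strictMonoOn {α β : Type*} [LinearOrder α] [WellFoundedLT α] [LinearOrder β]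
    {f g : α → β} {s : Set α} (hf : StrictMonoOn f s) (hg : StrictMonoOn g s)
    (h : f '' s = g '' s) : Set.EqOn f g s := by
  have key : ∀ {f g : α → β}, StrictMonoOn g s → f '' s = g '' s → ∀ x ∈ s,
      (∀ y ∈ s, y < x → f y = g y) → StrictMonoOn f s → ¬ f x < g x := by
    intro f g hg h x hx ih hf hlt
    obtain ⟨y, hy, hxy⟩ : f x ∈ g '' s := h ▸ Set.mem_image_of_mem f hx
    have hyx : y < x := (hg.lt_iff_lt hy hx).1 (hxy ▸ hlt)
    exact hyx.ne (hf.injOn hy hx ((ih y hy hyx).trans hxy))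
  intro x
  induction x using WellFoundedLT.induction with
  | ind x ih =>
    intro hx
    refine le_antisymm (not_lt.1 ?_) (not_lt.1 ?_)
    · exact key hf h.symm x hx (fun y hy hyx => (ih y hyx hy).symm) hg
    · exact key hg h x hx (fun y hy hyx => ih y hyx hy) hf

section

variable {n : ℕ} {σ : Equiv.Perm (Fin n)}

theorem mem_excPos {i : Fin n} : i ∈ excPos σ ↔ i < σ i := by simp [excPos]

theorem mem_excVal {i : Fin n} : i ∈ excVal σ ↔ σ⁻¹ i < i := by simp [excVal]

theorem map_excPos : (excPos σ).map σ.toEmbedding = excVal σ := by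
  ext x
  simp only [mem_map_equiv, mem_excPos, mem_excVal]
  simp [Equiv.Perm.inv_def]

theorem card_excPos : #(excPos σ) = exc σ := rfl

theorem cda_eq_zero_iff : cda σ = 0 ↔ Disjoint (excPos σ) (excVal σ) := by
  rw [cda, card_eq_zero, filter_eq_empty_iff, disjoint_left]
  simp only [mem_univ, forall_const, mem_excPos, mem_excVal]
  grind

/-- An excedance value `≤ i` sits at a position `< i`, so `σ⁻¹` embeds the first set counted into
the second. -/
theorem excPair_mem_strictPairs : (excPos σ, excVal σ) ∈ strictPairs n := by
  classical
  simp only [strictPairs, mem_filter, mem_univ, true_and, ← map_excPos, card_map]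
  intro i
  rw [filter_map, card_map]
  refine card_le_card fun x => ?_
  simp only [mem_filter, mem_excPos, Function.comp]
  intro ⟨h1, h2⟩
  exact ⟨h1, lt_of_lt_of_le h1 h2⟩

/-- An excedance has a smaller letter to its right. -/
theorem exists_gt_of_exc {i : Fin n} (h : i < σ i) : ∃ j, i < j ∧ σ j < σ i := by
  by_contra! hc
  have h1 : (Finset.Iic (σ i)).map σ⁻¹.toEmbedding ⊆ Finset.Iic i := by
    intro x
    simp only [mem_map_equiv, mem_Iic]
    intro hx
    have hx' : σ x ≤ σ i := by simpa [Equiv.Perm.inv_def] using hx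
    by_contra! hix
    exact hix.ne (σ.injective (le_antisymm (hc x hix) hx'))
  have h2 := card_le_card h1
  simp only [card_map, Fin.card_Iic] at h2
  omega

/-- A descent pair whose first position is not an excedance has a larger letter to its left. -/
theorem exists_lt_of_not_exc {i j : Fin n} (h : σ i ≤ i) (hij : i < j) (hσ : σ j < σ i) :
    ∃ k, k < i ∧ σ i < σ k := by
  by_contra! hc
  have h1 : (insert j (Finset.Iio i)).map σ.toEmbedding ⊆ Finset.Iio (σ i) := by
    intro x
    simp only [mem_map_equiv, mem_Iio, mem_insert]
    rintro (hx | hx)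
    · rw [← hx] at hσ
      simpa using hσ
    · have := lt_of_le_of_ne (hc _ hx) (fun h => hx.ne (σ.injective h))
      simpa using this
  have h2 := card_le_card h1
  rw [card_map, card_insert_of_notMem (by simp [hij.le]), Fin.card_Iio, Fin.card_Iio] at h2
  omega

/-- A decrease ending at an excedance extends to a 321 by a smaller letter further right. -/
theorem strictMonoOn_excPos (h : σ ∈ avoiders n ![3, 2, 1]) : StrictMonoOn σ (excPos σ) := by
  rw [mem_avoiders_321] at h
  intro i hi j hj hij
  by_contra! hc
  obtain ⟨k, hk, hσ⟩ := exists_gt_of_exc (mem_excPos.1 hj)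
  exact h i j k hij hk (lt_of_le_of_ne hc fun h => hij.ne' (σ.injective h)) hσ

theorem not_inv_of_not_exc (h : σ ∈ avoiders n ![3, 2, 1]) {i j : Fin n} (hi : σ i ≤ i)
    (hij : i < j) : σ i < σ j := by
  rw [mem_avoiders_321] at h
  by_contra! hc
  have hc' : σ j < σ i := lt_of_le_of_ne hc fun h => hij.ne' (σ.injective h)
  obtain ⟨k, hk, hσ⟩ := exists_lt_of_not_exc hi hij hc'
  exact h k i j hk hij hσ hc'

theorem strictMonoOn_compl_excPos (h : σ ∈ avoiders n ![3, 2, 1]) :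
    StrictMonoOn σ (excPos σ : Set (Fin n))ᶜ := by
  intro i hi j _ hij
  refine not_inv_of_not_exc h ?_ hij
  simpa [mem_excPos] using hi

theorem excPair_injOn : Set.InjOn (fun σ : Equiv.Perm (Fin n) => (excPos σ, excVal σ))
    (avoiders n ![3, 2, 1]) := by
  intro σ hσ τ hτ h
  simp only [Prod.mk.injEq] at h
  have h1 : ∀ ρ : Equiv.Perm (Fin n), ρ '' (excPos ρ) = excVal ρ := by
    intro ρ
    rw [← map_excPos]; simp
  have h2 : ∀ ρ : Equiv.Perm (Fin n), ρ '' (excPos ρ : Set (Fin n))ᶜ = (excVal ρ : Set (Fin n))ᶜ := by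
    intro ρ
    rw [Set.image_compl_eq ρ.bijective, h1]
  have e1 : Set.EqOn σ τ (excPos σ) := eqOn_of_strictMonoOn (strictMonoOn_excPos hσ)
    (h.1 ▸ strictMonoOn_excPos hτ) (by rw [h1, h.1, h1, h.2])
  have e2 : Set.EqOn σ τ (excPos σ : Set (Fin n))ᶜ :=
    eqOn_of_strictMonoOn (strictMonoOn_compl_excPos hσ)
    (h.1 ▸ strictMonoOn_compl_excPos hτ) (by rw [h2, h.1, h2, h.2])
  ext x
  by_cases hx : x ∈ excPos σ
  · rw [e1 hx]
  · rw [e2 hx]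

/-- In a `321`-avoiding permutation, the inversions are counted by the excedance lengths. -/
theorem inv_add_sum_excPos (h : σ ∈ avoiders n ![3, 2, 1]) :
    inv σ + ∑ i ∈ excPos σ, i.val = ∑ x ∈ excVal σ, x.val := by
  rw [← map_excPos, sum_map]
  have h1 : inv σ = ∑ i : Fin n, #{j : Fin n | i < j ∧ σ j < σ i} := by
    rw [inv, ← univ_product_univ, card_filter, sum_product]
    simp only [card_filter]
  have h2 : ∀ i : Fin n, i ∉ excPos σ → #{j : Fin n | i < j ∧ σ j < σ i} = 0 := by
    intro i hi
    rw [card_eq_zero, filter_eq_empty_iff]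
    rintro j - ⟨hij, hj⟩
    exact absurd (not_inv_of_not_exc h (by simpa [mem_excPos] using hi) hij) hj.asymm
  rw [h1, ← sum_subset (subset_univ (excPos σ)) fun i _ hi => h2 i hi, ← sum_add_distrib]
  refine sum_congr rfl fun i hi => ?_
  rw [mem_excPos] at hi
  have h3 : #{j : Fin n | σ j < σ i} = (σ i).val := by
    have : ({j : Fin n | σ j < σ i} : Finset (Fin n)).map σ.toEmbedding = Iio (σ i) := by
      ext x; simp
    rw [← card_map σ.toEmbedding, this, Fin.card_Iio]
  -- Some smaller letter follows the excedance `i`, so a larger letter before `i` would create a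
  -- 321. Hence all letters before `i` are smaller, and exactly `σ i - i` inversions start at `i`.
  have h4 : #{j : Fin n | σ j < σ i ∧ j ≤ i} = i.val := by
    rw [← Fin.card_Iio]
    congr 1
    ext j
    simp only [mem_filter, mem_univ, true_and, mem_Iio]
    refine ⟨fun ⟨h1, h2⟩ => lt_of_le_of_ne h2 (by rintro rfl; exact lt_irrefl _ h1), fun hj => ⟨?_, hj.le⟩⟩
    obtain ⟨k, hk, hσ⟩ := exists_gt_of_exc hi
    by_contra! hc
    exact mem_avoiders_321.1 h j i k hj hk
      (lt_of_le_of_ne hc fun h => hj.ne' (σ.injective h)) hσ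
  have h5 := card_filter_add_card_filter_not (s := ({j : Fin n | σ j < σ i} : Finset (Fin n)))
    (fun j => j ≤ i)
  rw [filter_filter, filter_filter, h4, h3] at h5
  simp only [not_le] at h5
  simp only [and_comm (a := i < _)]
  simp only [Equiv.toEmbedding_apply]
  omega

end

/-- The two increasing bijections `E → V` and `Eᶜ → Vᶜ` glue to a permutation. -/
theorem exists_perm_strictMonoOn {n : ℕ} {E V : Finset (Fin n)} (h : #E = #V) :
    ∃ σ : Equiv.Perm (Fin n), (∀ x, σ x ∈ V ↔ x ∈ E) ∧ StrictMonoOn σ E ∧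
      StrictMonoOn σ (E : Set (Fin n))ᶜ := by
  classical
  have h' : #Eᶜ = #Vᶜ := by rw [card_compl, card_compl, h]
  let f : E ≃o V := (E.orderIsoOfFin h).symm.trans (V.orderIsoOfFin rfl)
  let g : (Eᶜ : Finset (Fin n)) ≃o (Vᶜ : Finset (Fin n)) :=
    (Eᶜ.orderIsoOfFin h').symm.trans (Vᶜ.orderIsoOfFin rfl)
  let F : Fin n → Fin n := fun x =>
    if hx : x ∈ E then f ⟨x, hx⟩ else g ⟨x, mem_compl.2 hx⟩
  have F1 : ∀ x (hx : x ∈ E), F x = f ⟨x, hx⟩ := fun x hx => dif_pos hx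
  have F2 : ∀ x (hx : x ∉ E), F x = g ⟨x, mem_compl.2 hx⟩ := fun x hx => dif_neg hx
  have hF : ∀ x, F x ∈ V ↔ x ∈ E := by
    intro x
    by_cases hx : x ∈ E
    · rw [F1 x hx]; simp [hx]
    · rw [F2 x hx]
      simpa [hx] using mem_compl.1 (g ⟨x, mem_compl.2 hx⟩).2
  have m1 : StrictMonoOn F E := by
    intro x hx y hy hxy
    rw [F1 x hx, F1 y hy]
    exact f.strictMono hxy
  have m2 : StrictMonoOn F (E : Set (Fin n))ᶜ := by
    intro x hx y hy hxy
    rw [F2 x hx, F2 y hy]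
    exact g.strictMono hxy
  have inj : Function.Injective F := by
    intro x y hxy
    have : x ∈ E ↔ y ∈ E := by rw [← hF x, hxy, hF y]
    by_cases hx : x ∈ E
    · exact m1.injOn hx (this.1 hx) hxy
    · exact m2.injOn hx (fun hy => hx (this.2 hy)) hxy
  exact ⟨Equiv.ofBijective F (Finite.injective_iff_bijective.1 inj), hF, m1, m2⟩

theorem card_filter_lt_of_strictMonoOn {n : ℕ} {σ : Equiv.Perm (Fin n)} {E V : Finset (Fin n)}
    (hσ : ∀ x, σ x ∈ V ↔ x ∈ E) (hm : StrictMonoOn σ E) {x : Fin n} (hx : x ∈ E) :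
    #{v ∈ V | v < σ x} = #{e ∈ E | e < x} := by
  refine Eq.trans ?_ (card_map σ.toEmbedding)
  congr 1
  ext v
  obtain ⟨y, rfl⟩ := σ.surjective v
  simp only [mem_filter, hσ, mem_map_equiv, Equiv.symm_apply_apply]
  exact and_congr_right fun hy => hm.lt_iff_lt hy hx

theorem excPair_surj {n : ℕ} {E V : Finset (Fin n)} (h : (E, V) ∈ strictPairs n) :
    ∃ σ ∈ avoiders n ![3, 2, 1], (excPos σ, excVal σ) = (E, V) := by
  classical
  simp only [strictPairs, mem_filter, mem_univ, true_and] at h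
  obtain ⟨hc, hb⟩ := h
  obtain ⟨σ, hσ, m1, m2⟩ := exists_perm_strictMonoOn hc
  have hσ' : ∀ x, σ x ∈ Vᶜ ↔ x ∈ Eᶜ := by simp [hσ]
  -- Monotonicity puts as many elements of `V` below `σ x` as elements of `E` below `x`. If `σ x ≤
  -- x`, counting `σ x` itself breaks the bound at `i = σ x`.
  have a1 : ∀ x ∈ E, x < σ x := by
    intro x hx
    by_contra! hle
    have e1 := card_filter_lt_of_strictMonoOn hσ m1 hx
    have e2 : #{v ∈ V | v < σ x} < #{v ∈ V | v.val ≤ (σ x).val} := by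
      refine card_lt_card (ssubset_iff_of_subset ?_ |>.2 ⟨σ x, ?_, ?_⟩)
      · exact fun v hv => mem_filter.2 ⟨(mem_filter.1 hv).1, (mem_filter.1 hv).2.le⟩
      · simp [hσ, hx]
      · simp
    have e3 : #{e ∈ E | e.val < (σ x).val} ≤ #{e ∈ E | e < x} :=
      card_le_card fun v hv => mem_filter.2 ⟨(mem_filter.1 hv).1,
        lt_of_lt_of_le (Fin.lt_def.2 (mem_filter.1 hv).2) hle⟩
    have := hb (σ x)
    omega
  -- The same count on complements: the bound at `i = x` leaves more elements of `Vᶜ` up to `x` than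
  -- elements of `Eᶜ` below `x`, which `x < σ x` would forbid.
  have a2 : ∀ x ∉ E, σ x ≤ x := by
    intro x hx
    by_contra! hlt
    have e1 := card_filter_lt_of_strictMonoOn hσ' (by simpa using m2) (mem_compl.2 hx)
    have e2 : #{v ∈ Vᶜ | v ≤ x} ≤ #{v ∈ Vᶜ | v < σ x} :=
      card_le_card fun v hv => mem_filter.2 ⟨(mem_filter.1 hv).1,
        lt_of_le_of_lt (mem_filter.1 hv).2 hlt⟩
    have cnt : ∀ (S : Finset (Fin n)) (p : Fin n → Prop) [DecidablePred p],
        #{v ∈ S | p v} + #{v ∈ Sᶜ | p v} = #{v : Fin n | p v} := by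
      intro S p _
      rw [← card_union_of_disjoint, ← filter_union, union_compl]
      exact disjoint_filter_filter disjoint_compl_right
    have c1 := cnt V (fun v => v ≤ x)
    have c2 := cnt E (fun v => v < x)
    have c3 : #{v : Fin n | v ≤ x} = x.val + 1 := by
      rw [← Fin.card_Iic]; congr 1; ext; simp
    have c4 : #{v : Fin n | v < x} = x.val := by
      rw [← Fin.card_Iio]; congr 1; ext; simp
    have := hb x
    simp only [← Fin.le_def, ← Fin.lt_def] at this
    omega
  have hE : excPos σ = E := by
    ext x
    rw [mem_excPos]
    refine ⟨fun hx => ?_, a1 x⟩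
    by_contra hc
    exact absurd hx (not_lt.2 (a2 x hc))
  refine ⟨σ, mem_avoiders_321.2 fun i j k hij hjk h1 h2 => ?_, ?_⟩
  -- Two of the three positions lie on the same side of `E`, where `σ` is increasing.
  · by_cases hi : i ∈ E <;> by_cases hj : j ∈ E <;> by_cases hk : k ∈ E
    · exact h1.asymm (m1 hi hj hij)
    · exact h1.asymm (m1 hi hj hij)
    · exact (h2.trans h1).asymm (m1 hi hk (hij.trans hjk))
    · exact h2.asymm (m2 hj hk hjk)
    · exact h2.asymm (m1 hj hk hjk)
    · exact (h2.trans h1).asymm (m2 hi hk (hij.trans hjk))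
    · exact h1.asymm (m2 hi hj hij)
    · exact h1.asymm (m2 hi hj hij)
  · rw [← map_excPos, hE]
    congr 1
    ext v
    obtain ⟨y, rfl⟩ := σ.surjective v
    simp [hσ]

theorem sum_avoiders_321 {M : Type*} [AddCommMonoid M] {n : ℕ}
    (g : Finset (Fin n) × Finset (Fin n) → M) :
    ∑ σ ∈ avoiders n ![3, 2, 1], g (excPos σ, excVal σ) = ∑ p ∈ strictPairs n, g p :=
  sum_nbij (fun σ => (excPos σ, excVal σ)) (fun _ _ => excPair_mem_strictPairs) excPair_injOn
    (fun _ hp => excPair_surj hp) fun _ _ => rfl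

/-! ### Ballot pairs and Motzkin pairs. -/

open scoped Classical in
/-- Pairs `(E, V)` of equinumerous sets such that `V` never gets ahead of `E`. -/
noncomputable def ballotPairs (m : ℕ) : Finset (Finset (Fin m) × Finset (Fin m)) :=
  {p | #p.1 = #p.2 ∧ ∀ i : ℕ, #{v ∈ p.2 | v.val < i} ≤ #{e ∈ p.1 | e.val < i}}

open scoped Classical in
/-- The sets `(E, V)` of up and down steps of the Motzkin paths of length `m`. -/
noncomputable def motzkinPairs (m : ℕ) : Finset (Finset (Fin m) × Finset (Fin m)) :=
  {p ∈ ballotPairs m | Disjoint p.1 p.2}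

theorem mem_ballotPairs {m : ℕ} {p : Finset (Fin m) × Finset (Fin m)} : p ∈ ballotPairs m ↔
    #p.1 = #p.2 ∧ ∀ i : ℕ, #{v ∈ p.2 | v.val < i} ≤ #{e ∈ p.1 | e.val < i} := by
  simp [ballotPairs]

theorem mem_strictPairs {m : ℕ} {p : Finset (Fin m) × Finset (Fin m)} : p ∈ strictPairs m ↔
    #p.1 = #p.2 ∧ ∀ i : ℕ, #{v ∈ p.2 | v.val ≤ i} ≤ #{e ∈ p.1 | e.val < i} := by
  simp [strictPairs]

theorem mem_motzkinPairs {m : ℕ} {p : Finset (Fin m) × Finset (Fin m)} :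
    p ∈ motzkinPairs m ↔ p ∈ ballotPairs m ∧ Disjoint p.1 p.2 := by
  simp [motzkinPairs]

/-- The two conditions differ at `i` only if `i ∈ V`. Then `i ∉ E` by disjointness, so the weak
bound at `i + 1` is the strict bound at `i`. -/
theorem mem_motzkinPairs_iff_strict {m : ℕ} {p : Finset (Fin m) × Finset (Fin m)} :
    p ∈ motzkinPairs m ↔ p ∈ strictPairs m ∧ Disjoint p.1 p.2 := by
  rw [mem_motzkinPairs, mem_ballotPairs, mem_strictPairs]
  refine and_congr_left fun hd => and_congr_right fun _ => ⟨fun h i => ?_, fun h i => ?_⟩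
  · by_cases hi : ∃ v ∈ p.2, v.val = i
    · obtain ⟨v, hv, rfl⟩ := hi
      refine le_trans (le_of_eq ?_) ((h (v + 1)).trans (le_of_eq ?_))
      · simp only [Nat.lt_succ_iff]
      · congr 1
        refine filter_congr fun e he => ?_
        have : e ≠ v := fun h => disjoint_left.1 hd he (h ▸ hv)
        rw [Ne, ← Fin.val_inj] at this
        omega
    · refine le_trans (le_of_eq ?_) (h i)
      congr 1
      refine filter_congr fun v hv => ?_
      have : v.val ≠ i := fun h => hi ⟨v, hv, h⟩
      omega
  · refine le_trans (card_le_card ?_) (h i)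
    exact fun v hv => mem_filter.2 ⟨(mem_filter.1 hv).1, (mem_filter.1 hv).2.le⟩

open scoped Classical in
theorem sum_tilde321 {M : Type*} [AddCommMonoid M] (m k : ℕ)
    (g : Finset (Fin m) × Finset (Fin m) → M) :
    ∑ σ ∈ tilde321 m k, g (excPos σ, excVal σ) = ∑ p ∈ motzkinPairs m with #p.1 = k, g p := by
  have h := sum_avoiders_321 fun p : Finset (Fin m) × Finset (Fin m) =>
    if #p.1 = k ∧ Disjoint p.1 p.2 then g p else 0
  rw [← sum_filter, ← sum_filter] at h
  convert h using 2
  · ext σ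
    rw [tilde321, mem_filter, mem_filter, cda_eq_zero_iff]
    rfl
  · ext p
    simp only [mem_filter, mem_motzkinPairs_iff_strict]
    tauto

/-- Shifting the excedance values of a permutation of size `m + 1` down by one. -/
theorem sum_strictPairs_succ {M : Type*} [AddCommMonoid M] (m : ℕ)
    (g : Finset (Fin (m + 1)) × Finset (Fin (m + 1)) → M) :
    ∑ p ∈ strictPairs (m + 1), g p =
      ∑ p ∈ ballotPairs m, g (p.1.map Fin.castSuccEmb, p.2.map (Fin.succEmb m)) := by
  symm
  have hV : ∀ (V : Finset (Fin m)) (i : ℕ),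
      #{v ∈ V.map (Fin.succEmb m) | v.val ≤ i} = #{v ∈ V | v.val < i} := by
    intro V i
    rw [filter_map, card_map]
    simp [Function.comp_def]
  have hE : ∀ (E : Finset (Fin m)) (i : ℕ),
      #{e ∈ E.map Fin.castSuccEmb | e.val < i} = #{e ∈ E | e.val < i} := by
    intro E i
    rw [filter_map, card_map]
    rfl
  refine sum_nbij (fun p => (p.1.map Fin.castSuccEmb, p.2.map (Fin.succEmb m)))
    ?_ ?_ ?_ fun _ _ => rfl
  · intro p hp
    rw [mem_ballotPairs] at hp
    simpa only [mem_strictPairs, hV, hE, card_map] using hp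
  · rintro ⟨E, V⟩ - ⟨E', V'⟩ - h
    simpa using h
  · rintro ⟨E, V⟩ hp
    have hp := mem_strictPairs.1 (mem_coe.1 hp)
    simp only at hp
    -- The bounds at `i = 0` and `i = m` exclude `0` from `V` and the last element from `E`, so
    -- undoing the shift loses nothing.
    have h0 : (0 : Fin (m + 1)) ∉ V := by
      intro h
      have h1 := hp.2 0
      simp only [Nat.not_lt_zero, filter_false, card_empty, Nat.le_zero, card_eq_zero,
        filter_eq_empty_iff] at h1
      exact h1 h rfl
    have hl : Fin.last m ∉ E := by
      intro h
      have h1 := hp.2 m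
      have h2 : #{e ∈ E | e.val < m} < #E :=
        card_lt_card (filter_ssubset.2 ⟨_, h, by simp⟩)
      rw [filter_true_of_mem fun v _ => Nat.lt_succ_iff.1 v.2] at h1
      omega
    have eE : (({i | Fin.castSucc i ∈ E} : Finset (Fin m))).map Fin.castSuccEmb = E := by
      ext x
      induction x using Fin.lastCases with
      | last => simp [hl]
      | cast x => simp
    have eV : (({i | Fin.succ i ∈ V} : Finset (Fin m))).map (Fin.succEmb m) = V := by
      ext x
      induction x using Fin.cases with
      | zero => simp [h0]
      | succ x => simp
    refine ⟨(({i | Fin.castSucc i ∈ E} : Finset (Fin m)), ({i | Fin.succ i ∈ V} : Finset (Fin m))),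
      ?_, by simp only [eE, eV]⟩
    rw [mem_coe, mem_ballotPairs]
    refine ⟨?_, fun i => ?_⟩
    · rw [← card_map Fin.castSuccEmb, eE, ← card_map (Fin.succEmb m), eV]
      exact hp.1
    · simp only
      have := hp.2 i
      rwa [← eE, ← eV, hE, hV] at this

open scoped Classical in
/-- A pair is a Motzkin pair together with a set of common elements. -/
theorem sum_ballotPairs {M : Type*} [AddCommMonoid M] (m : ℕ)
    (g : Finset (Fin m) × Finset (Fin m) → M) :
    ∑ p ∈ ballotPairs m, g p =
      ∑ p ∈ motzkinPairs m, ∑ C ∈ (p.1 ∪ p.2)ᶜ.powerset, g (p.1 ∪ C, p.2 ∪ C) := by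
  -- Adjoining `C` raises both sides of every ballot inequality equally. Conversely, `C` is
  -- recovered as the intersection of the two sets.
  have hcard : ∀ {E V C : Finset (Fin m)}, C ⊆ (E ∪ V)ᶜ →
      ((E ∪ C, V ∪ C) ∈ ballotPairs m ↔ (E, V) ∈ ballotPairs m) := by
    intro E V C hC
    have dE : Disjoint E C := disjoint_left.2 fun x hx hc => by
      have := hC hc; simp [hx] at this
    have dV : Disjoint V C := disjoint_left.2 fun x hx hc => by
      have := hC hc; simp [hx] at this
    rw [mem_ballotPairs, mem_ballotPairs]
    simp only [filter_union]
    rw [card_union_of_disjoint dE, card_union_of_disjoint dV, add_left_inj]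
    refine and_congr_right fun _ => forall_congr' fun i => ?_
    rw [card_union_of_disjoint (disjoint_filter_filter dE),
      card_union_of_disjoint (disjoint_filter_filter dV), add_le_add_iff_right]
  rw [sum_sigma']
  symm
  refine sum_bij' (fun x _ => (x.1.1 ∪ x.2, x.1.2 ∪ x.2))
    (fun p _ => ⟨(p.1 \ p.2, p.2 \ p.1), p.1 ∩ p.2⟩) ?_ ?_ ?_ ?_ ?_
  · rintro ⟨⟨E, V⟩, C⟩ h
    simp only [mem_sigma, mem_powerset, mem_motzkinPairs] at h
    exact (hcard h.2).2 h.1.1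
  · rintro ⟨E, V⟩ h
    have hC : E ∩ V ⊆ ((E \ V) ∪ (V \ E))ᶜ := by
      intro x; simp; tauto
    simp only [mem_sigma, mem_powerset, mem_motzkinPairs]
    refine ⟨⟨(hcard hC).1 ?_, ?_⟩, hC⟩
    · convert h using 2
      · ext x; simp; tauto
      · ext x; simp; tauto
    · exact disjoint_left.2 fun x => by simp; tauto
  · rintro ⟨⟨E, V⟩, C⟩ h
    simp only [mem_sigma, mem_powerset, mem_motzkinPairs, subset_iff, mem_compl, mem_union,
      disjoint_left] at h
    obtain ⟨⟨-, h1⟩, h2⟩ := h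
    have e1 : (E ∪ C) \ (V ∪ C) = E := by ext x; grind
    have e2 : (V ∪ C) \ (E ∪ C) = V := by ext x; grind
    have e3 : (E ∪ C) ∩ (V ∪ C) = C := by ext x; grind
    simp only [e1, e2, e3]
  · rintro ⟨E, V⟩ h
    simp only [Prod.mk.injEq]
    constructor <;> (ext x; simp; tauto)
  · intros; rfl

theorem two_mul_card_le {m : ℕ} {p : Finset (Fin m) × Finset (Fin m)} (hp : p ∈ motzkinPairs m) :
    #p.1 + #p.1 ≤ m ∧ #(p.1 ∪ p.2)ᶜ = m - 2 * #p.1 := by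
  classical
  rw [mem_motzkinPairs, mem_ballotPairs] at hp
  have h1 := card_union_of_disjoint hp.2
  have h2 := card_compl (p.1 ∪ p.2)
  have h3 := card_le_univ (p.1 ∪ p.2)
  rw [Fintype.card_fin] at h2 h3
  omega

/-! ### The gamma expansion over Motzkin pairs. -/

theorem inv_eq_sum_sub {m : ℕ} {σ : Equiv.Perm (Fin m)} (h : σ ∈ avoiders m ![3, 2, 1]) :
    inv σ = ∑ x ∈ excVal σ, x.val - ∑ i ∈ excPos σ, i.val := by
  have := inv_add_sum_excPos h
  omega

open scoped Classical in
theorem gammaPoly_eq (m k : ℕ) : gammaPoly m k = ∑ p ∈ motzkinPairs m with #p.1 = k,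
    (Polynomial.X : Polynomial ℕ) ^ (∑ x ∈ p.2, x.val - ∑ i ∈ p.1, i.val) := by
  rw [← sum_tilde321, gammaPoly]
  refine sum_congr rfl fun σ hσ => ?_
  rw [inv_eq_sum_sub (mem_filter.1 hσ).1]

open scoped Classical in
theorem aeval_gammaPoly {K : Type*} [Field K] (q : K) (m k : ℕ) :
    Polynomial.aeval q (gammaPoly m k) = ∑ p ∈ motzkinPairs m with #p.1 = k,
    q ^ (((∑ x ∈ p.2, x.val : ℕ) : ℤ) - ((∑ i ∈ p.1, i.val : ℕ) : ℤ)) := by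
  rw [← sum_tilde321 m k fun p : Finset (Fin m) × Finset (Fin m) =>
    q ^ (((∑ x ∈ p.2, x.val : ℕ) : ℤ) - ((∑ i ∈ p.1, i.val : ℕ) : ℤ)), gammaPoly, map_sum]
  refine sum_congr rfl fun σ hσ => ?_
  rw [← inv_add_sum_excPos (mem_filter.1 hσ).1, map_pow, Polynomial.aeval_X]
  push_cast
  rw [add_sub_cancel_right, zpow_natCast]

theorem qNarayana_div {K : Type*} [Field K] {t q : K} (hq : q ≠ 0) (n : ℕ) :
    qNarayana n (t / q) q 1 = ∑ σ ∈ avoiders n ![3, 2, 1],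
      t ^ exc σ * q ^ ((inv σ : ℤ) - (exc σ : ℤ)) := by
  refine sum_congr rfl fun σ _ => ?_
  rw [one_pow, mul_one, div_pow, zpow_sub₀ hq, zpow_natCast, zpow_natCast]
  ring

theorem qNarayana_succ {K : Type*} [Field K] {t q : K} (hq : q ≠ 0) (m : ℕ) :
    qNarayana (m + 1) (t / q) q 1 = ∑ k ∈ range (m / 2 + 1),
      Polynomial.aeval q (gammaPoly m k) * t ^ k * (1 + t) ^ (m - 2 * k) := by
  classical
  have h1 : qNarayana (m + 1) (t / q) q 1 = ∑ σ ∈ avoiders (m + 1) ![3, 2, 1],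
      t ^ #(excPos σ) * q ^ (((∑ x ∈ excVal σ, x.val : ℕ) : ℤ) -
        ((∑ i ∈ excPos σ, i.val : ℕ) : ℤ) - (#(excPos σ) : ℤ)) := by
    rw [qNarayana_div hq]
    refine sum_congr rfl fun σ hσ => ?_
    rw [← inv_add_sum_excPos hσ, card_excPos]
    push_cast
    rw [add_sub_cancel_right]
  rw [h1, sum_avoiders_321 fun p : Finset (Fin (m + 1)) × Finset (Fin (m + 1)) =>
    t ^ #p.1 * q ^ (((∑ x ∈ p.2, x.val : ℕ) : ℤ) -
        ((∑ i ∈ p.1, i.val : ℕ) : ℤ) - (#p.1 : ℤ)), sum_strictPairs_succ, sum_ballotPairs]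
  have h2 : ∀ p ∈ motzkinPairs m, #p.1 ∈ range (m / 2 + 1) := by
    intro p hp
    have := (two_mul_card_le hp).1
    rw [mem_range]
    omega
  rw [← sum_fiberwise_of_maps_to h2]
  refine sum_congr rfl fun k _ => ?_
  rw [aeval_gammaPoly, sum_mul, sum_mul]
  refine sum_congr rfl fun p hp => ?_
  rw [mem_filter] at hp
  obtain ⟨hp, rfl⟩ := hp
  -- The power of `1 + t` is expanded over the subsets `C` of the level steps, matching the inner
  -- sum term by term.
  rw [← (two_mul_card_le hp).2, add_comm 1 t, ← sum_pow_mul_eq_add_pow, mul_sum]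
  refine sum_congr rfl fun C hC => ?_
  have hC := mem_powerset.1 hC
  have hb := mem_motzkinPairs.1 hp
  have hcard := (mem_ballotPairs.1 hb.1).1
  have dE : Disjoint p.1 C := disjoint_left.2 fun x hx hc => by
    have := hC hc; simp [hx] at this
  have dV : Disjoint p.2 C := disjoint_left.2 fun x hx hc => by
    have := hC hc; simp [hx] at this
  simp only [sum_map, card_map, card_union_of_disjoint dE, Fin.coe_succEmb, Fin.val_succ,
    Fin.coe_castSuccEmb, Fin.val_castSucc, sum_add_distrib, sum_const, sum_union dE, sum_union dV,
    one_pow, mul_one, pow_add, smul_eq_mul]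
  -- Here `a`, `c`, `b` are the sums over `p.2`, `p.1`, `C`, while `d` and `e` are the sizes of
  -- `p.2` and `C`. The shift adds `d + e`, which the subtracted excedance number removes.
  have hexp : ∀ a b c d e : ℕ, ((a + d + (b + e) : ℕ) : ℤ) - ((c + b : ℕ) : ℤ) -
      ((d + e : ℕ) : ℤ) = a - c := by
    intros
    push_cast
    ring
  rw [hcard, hexp]
  ring

/-! ### Noncrossing matchings of Motzkin pairs. -/

/-- `d` is a bijection from `V` to `E` whose arcs `(d c, c)` are noncrossing, with `d c < c`. -/
structure NoncrossingMatching {m : ℕ} (E V : Finset (Fin m)) (d : Fin m → Fin m) : Prop where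
  bijOn : Set.BijOn d V E
  lt : ∀ c ∈ V, d c < c
  noncrossing : ∀ b ∈ V, ∀ c ∈ V, d c < b → b < c → d c < d b

theorem NoncrossingMatching.mem_ballotPairs {m : ℕ} {E V : Finset (Fin m)} {d : Fin m → Fin m}
    (h : NoncrossingMatching E V d) : (E, V) ∈ ballotPairs m := by
  rw [PermStat.mem_ballotPairs]
  refine ⟨(card_bij (fun c _ => d c) (fun c hc => h.bijOn.mapsTo hc)
    (fun b hb c hc hbc => h.bijOn.injOn hb hc hbc) fun e he => ?_).symm, fun i => ?_⟩
  · obtain ⟨c, hc, rfl⟩ := h.bijOn.surjOn he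
    exact ⟨c, hc, rfl⟩
  · refine card_le_card_of_injOn d ?_ fun b hb c hc hbc => ?_
    · intro c hc
      rw [mem_coe, mem_filter] at hc ⊢
      exact ⟨h.bijOn.mapsTo hc.1, lt_trans (Fin.lt_def.1 (h.lt c hc.1)) hc.2⟩
    · rw [mem_coe, mem_filter] at hb hc
      exact h.bijOn.injOn hb.1 hc.1 hbc

/-- At a first disagreement `d c < d' c`, write `d' c = d b`. If `b < c`, then `d'` is not
injective; if `b > c`, the arcs of `d` at `b` and `c` cross. -/
theorem NoncrossingMatching.eqOn {m : ℕ} {E V : Finset (Fin m)} {d d' : Fin m → Fin m}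
    (h : NoncrossingMatching E V d) (h' : NoncrossingMatching E V d') : Set.EqOn d d' V := by
  have key : ∀ {d d' : Fin m → Fin m}, NoncrossingMatching E V d → NoncrossingMatching E V d' →
      ∀ c ∈ V, (∀ b ∈ V, b < c → d b = d' b) → ¬ d c < d' c := by
    intro d d' h h' c hc ih hlt
    obtain ⟨b, hb, hbe⟩ := h.bijOn.surjOn (h'.bijOn.mapsTo hc)
    rcases lt_trichotomy b c with hbc | rfl | hbc
    · exact hbc.ne (h'.bijOn.injOn hb hc ((ih b hb hbc).symm.trans hbe))
    · exact hlt.ne hbe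
    · have := h.noncrossing c hc b hb (hbe ▸ h'.lt c hc) hbc
      exact hlt.asymm (hbe ▸ this)
  intro c
  induction c using WellFoundedLT.induction with
  | ind c ih =>
    intro hc
    refine le_antisymm (not_lt.1 ?_) (not_lt.1 ?_)
    · exact key h' h c hc fun b hb hbc => (ih b hbc hb).symm
    · exact key h h' c hc fun b hb hbc => ih b hbc hb

/-- Induction on the size of `V`: the least `c ∈ V` is matched with the largest `a ∈ E` below it.
Removing both keeps the ballot condition, since no element of `V` lies below `c` and both counts
drop by one beyond it. An arc opening before `c` then opens before `a`, so it does not cross the new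
arc. -/
theorem exists_noncrossingMatching {m : ℕ} {E V : Finset (Fin m)} (hp : (E, V) ∈ motzkinPairs m) :
    ∃ d, NoncrossingMatching E V d := by
  classical
  induction hk : #V generalizing E V with
  | zero =>
    rw [mem_motzkinPairs, mem_ballotPairs] at hp
    rw [card_eq_zero] at hk
    subst hk
    obtain rfl : E = ∅ := by simpa using hp.1.1
    exact ⟨id, by simp, by simp, by simp⟩
  | succ k ih =>
    rw [mem_motzkinPairs, mem_ballotPairs] at hp
    obtain ⟨⟨hcard, hb⟩, hd⟩ := hp
    simp only at hcard hb hd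
    have hV : V.Nonempty := card_pos.1 (by omega)
    set c := V.min' hV with hc
    have hcV : c ∈ V := V.min'_mem hV
    have hcmin : ∀ x ∈ V, c ≤ x := fun x hx => V.min'_le x hx
    have hEc : ({e ∈ E | e < c} : Finset (Fin m)).Nonempty := by
      have h1 := hb (c.val + 1)
      have h2 : 0 < #{v ∈ V | v.val < c.val + 1} := card_pos.2 ⟨c, mem_filter.2 ⟨hcV, by omega⟩⟩
      obtain ⟨e, he⟩ := card_pos.1 (h2.trans_le h1)
      rw [mem_filter] at he
      refine ⟨e, mem_filter.2 ⟨he.1, ?_⟩⟩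
      have : e ≠ c := fun h => disjoint_left.1 hd he.1 (h ▸ hcV)
      omega
    set a := ({e ∈ E | e < c} : Finset (Fin m)).max' hEc with ha
    have haE' : a ∈ E ∧ a < c := mem_filter.1 (max'_mem _ hEc)
    obtain ⟨haE, hac⟩ := haE'
    have hamax : ∀ e ∈ E, e < c → e ≤ a := fun e he hec => le_max' _ _ (mem_filter.2 ⟨he, hec⟩)
    have hp' : (E.erase a, V.erase c) ∈ motzkinPairs m := by
      rw [mem_motzkinPairs, mem_ballotPairs]
      refine ⟨⟨?_, fun i => ?_⟩, ?_⟩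
      · simp only [card_erase_of_mem haE, card_erase_of_mem hcV, hcard]
      · simp only [filter_erase]
        have hac' := Fin.lt_def.1 hac
        by_cases hi : c.val < i
        · rw [card_erase_of_mem (mem_filter.2 ⟨haE, hac'.trans hi⟩),
            card_erase_of_mem (mem_filter.2 ⟨hcV, hi⟩)]
          exact Nat.sub_le_sub_right (hb i) 1
        · rw [filter_false_of_mem]
          · simp
          · intro v hv hvi
            have := hcmin v hv
            rw [Fin.le_def] at this
            omega
      · exact hd.mono (erase_subset _ _) (erase_subset _ _)
    obtain ⟨d, hd⟩ := ih hp' (by rw [card_erase_of_mem hcV]; omega)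
    have hu : ∀ b, b ≠ c → Function.update d c a b = d b := fun b hb =>
      Function.update_of_ne hb _ _
    have hmem : ∀ b ∈ V, b ≠ c → b ∈ (V.erase c : Finset (Fin m)) := fun b hb hbc =>
      mem_erase.2 ⟨hbc, hb⟩
    have hdE : ∀ b ∈ V, b ≠ c → d b ∈ E.erase a := fun b hb hbc =>
      hd.bijOn.mapsTo (hmem b hb hbc)
    refine ⟨Function.update d c a, ⟨?_, ?_, ?_⟩, ?_, ?_⟩
    · intro b hb
      by_cases hbc : b = c
      · subst hbc; simpa using haE
      · rw [hu b hbc]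
        exact (mem_erase.1 (hdE b hb hbc)).2
    · intro b hb b' hb' h
      by_cases hbc : b = c <;> by_cases hbc' : b' = c
      · rw [hbc, hbc']
      · rw [hbc, hu b' hbc', Function.update_self] at h
        exact absurd h.symm (mem_erase.1 (hdE b' hb' hbc')).1
      · rw [hbc', hu b hbc, Function.update_self] at h
        exact absurd h (mem_erase.1 (hdE b hb hbc)).1
      · rw [hu b hbc, hu b' hbc'] at h
        exact hd.bijOn.injOn (hmem b hb hbc) (hmem b' hb' hbc') h
    · intro e he
      by_cases hea : e = a
      · exact ⟨c, hcV, by simp [hea]⟩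
      · obtain ⟨b, hb, rfl⟩ := hd.bijOn.surjOn (mem_coe.2 (mem_erase.2 ⟨hea, he⟩))
        have hb := mem_erase.1 (mem_coe.1 hb)
        exact ⟨b, hb.2, hu b hb.1⟩
    · intro b hb
      by_cases hbc : b = c
      · rw [hbc, Function.update_self]; exact hac
      · rw [hu b hbc]
        exact hd.lt b (hmem b hb hbc)
    · intro b hb b' hb'
      by_cases hbc' : b' = c
      · rw [hbc']
        intro _ h
        exact absurd (hcmin b hb) (not_le.2 h)
      · rw [hu b' hbc']
        by_cases hbc : b = c
        · rw [hbc, Function.update_self]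
          intro h1 _
          have h2 := mem_erase.1 (hdE b' hb' hbc')
          exact lt_of_le_of_ne (hamax _ h2.2 h1) h2.1
        · rw [hu b hbc]
          exact hd.noncrossing b (hmem b hb hbc) b' (hmem b' hb' hbc')

/-! ### 231-avoiding permutations encoded by descent bottoms and tops. -/

/-- The values at the tops of the descents. -/
def desTop {m : ℕ} (σ : Equiv.Perm (Fin m)) : Finset (Fin m) :=
  {c | ∃ i j : Fin m, i.val + 1 = j.val ∧ σ j < σ i ∧ σ i = c}

/-- The values at the bottoms of the descents. -/
def desBot {m : ℕ} (σ : Equiv.Perm (Fin m)) : Finset (Fin m) :=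
  {a | ∃ i j : Fin m, i.val + 1 = j.val ∧ σ j < σ i ∧ σ j = a}

section

variable {m : ℕ} {σ : Equiv.Perm (Fin m)}

theorem mem_desTop {c : Fin m} :
    c ∈ desTop σ ↔ ∃ i j : Fin m, i.val + 1 = j.val ∧ σ j < σ i ∧ σ i = c := by simp [desTop]

theorem mem_desBot {c : Fin m} :
    c ∈ desBot σ ↔ ∃ i j : Fin m, i.val + 1 = j.val ∧ σ j < σ i ∧ σ j = c := by simp [desBot]

theorem padded_succ (l r : ℕ∞) (i : Fin m) : padded σ l r (i.val + 1) = ((σ i).val + 1 : ℕ) := by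
  simp [padded]

theorem padded_zero (l r : ℕ∞) : padded σ l r 0 = l := rfl

theorem padded_last (l r : ℕ∞) : padded σ l r (m + 1) = r := by simp [padded]

/-- With `0` on the left and `∞` on the right, neither end of the word can be a double descent, so
only interior triples matter. -/
theorem ldd_eq_zero_iff : ldd σ = 0 ↔ ∀ i j k : Fin m, i.val + 1 = j.val → j.val + 1 = k.val →
    σ j < σ i → ¬ σ k < σ j := by
  rw [ldd, card_eq_zero, filter_eq_empty_iff]
  constructor
  · intro h i j k hij hjk h1 h2
    refine h (x := j.val + 1) (by simp) ?_
    rw [padded_succ, Nat.add_sub_cancel, ← hij, padded_succ, hij, hjk, padded_succ]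
    simp only [gt_iff_lt, Nat.cast_lt]
    omega
  · rintro h x hx ⟨h1, h2⟩
    rw [mem_Icc] at hx
    obtain ⟨y, rfl⟩ := Nat.exists_eq_add_of_le' hx.1
    have hy : y < m := hx.2
    rw [Nat.add_sub_cancel] at h1
    rcases y with _ | y
    · simp [padded_zero] at h1
    rcases Nat.eq_or_lt_of_le (Nat.succ_le_of_lt hy) with hl | hl
    · rw [show y + 1 + 1 = m from hl, padded_last] at h2
      simp at h2
    · have e1 := padded_succ (σ := σ) 0 ⊤ ⟨y, by omega⟩
      have e2 := padded_succ (σ := σ) 0 ⊤ ⟨y + 1, hy⟩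
      have e3 := padded_succ (σ := σ) 0 ⊤ ⟨y + 1 + 1, hl⟩
      simp only at e1 e2 e3
      rw [e1, e2, gt_iff_lt, Nat.cast_lt] at h1
      rw [e2, e3, gt_iff_lt, Nat.cast_lt] at h2
      exact h ⟨y, by omega⟩ ⟨y + 1, hy⟩ ⟨y + 1 + 1, hl⟩ rfl rfl (by omega) (by omega)

theorem rda_eq_zero_iff : rda σ = 0 ↔ ∀ i j k : Fin m, i.val + 1 = j.val → j.val + 1 = k.val →
    σ i < σ j → ¬ σ j < σ k := by
  rw [rda, card_eq_zero, filter_eq_empty_iff]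
  constructor
  · intro h i j k hij hjk h1 h2
    refine h (x := j.val + 1) (by simp) ?_
    rw [padded_succ, Nat.add_sub_cancel, ← hij, padded_succ, hij, hjk, padded_succ]
    simp only [Nat.cast_lt]
    omega
  · rintro h x hx ⟨h1, h2⟩
    rw [mem_Icc] at hx
    obtain ⟨y, rfl⟩ := Nat.exists_eq_add_of_le' hx.1
    have hy : y < m := hx.2
    rw [Nat.add_sub_cancel] at h1
    rcases y with _ | y
    · simp [padded_zero] at h1
    rcases Nat.eq_or_lt_of_le (Nat.succ_le_of_lt hy) with hl | hl
    · rw [show y + 1 + 1 = m from hl, padded_last] at h2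
      simp at h2
    · have e1 := padded_succ (σ := σ) ⊤ 0 ⟨y, by omega⟩
      have e2 := padded_succ (σ := σ) ⊤ 0 ⟨y + 1, hy⟩
      have e3 := padded_succ (σ := σ) ⊤ 0 ⟨y + 1 + 1, hl⟩
      simp only at e1 e2 e3
      rw [e1, e2, Nat.cast_lt] at h1
      rw [e2, e3, Nat.cast_lt] at h2
      exact h ⟨y, by omega⟩ ⟨y + 1, hy⟩ ⟨y + 1 + 1, hl⟩ rfl rfl (by omega) (by omega)

/-- The descent pairs of positions. -/
def desPairs {m : ℕ} (σ : Equiv.Perm (Fin m)) : Finset (Fin m × Fin m) :=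
  {p | p.1.val + 1 = p.2.val ∧ σ p.2 < σ p.1}

theorem mem_desPairs {p : Fin m × Fin m} :
    p ∈ desPairs σ ↔ p.1.val + 1 = p.2.val ∧ σ p.2 < σ p.1 := by simp [desPairs]

theorem sum_desTop {M : Type*} [AddCommMonoid M] (f : Fin m → M) :
    ∑ c ∈ desTop σ, f c = ∑ p ∈ desPairs σ, f (σ p.1) := by
  symm
  refine sum_nbij (fun p => σ p.1) ?_ ?_ ?_ fun _ _ => rfl
  · intro p hp
    rw [mem_desPairs] at hp
    exact mem_desTop.2 ⟨p.1, p.2, hp.1, hp.2, rfl⟩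
  · intro p hp q hq hpq
    have hp := mem_desPairs.1 hp
    have hq := mem_desPairs.1 hq
    have h1 : p.1 = q.1 := σ.injective hpq
    refine Prod.ext h1 (Fin.ext ?_)
    rw [← hp.1, ← hq.1, h1]
  · intro c hc
    obtain ⟨i, j, hij, hσ, rfl⟩ := mem_desTop.1 hc
    exact ⟨(i, j), mem_desPairs.2 ⟨hij, hσ⟩, rfl⟩

theorem sum_desBot {M : Type*} [AddCommMonoid M] (f : Fin m → M) :
    ∑ c ∈ desBot σ, f c = ∑ p ∈ desPairs σ, f (σ p.2) := by
  symm
  refine sum_nbij (fun p => σ p.2) ?_ ?_ ?_ fun _ _ => rfl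
  · intro p hp
    rw [mem_desPairs] at hp
    exact mem_desBot.2 ⟨p.1, p.2, hp.1, hp.2, rfl⟩
  · intro p hp q hq hpq
    have hp := mem_desPairs.1 hp
    have hq := mem_desPairs.1 hq
    have h1 : p.2 = q.2 := σ.injective hpq
    refine Prod.ext (Fin.ext ?_) h1
    have := congrArg Fin.val h1
    omega
  · intro c hc
    obtain ⟨i, j, hij, hσ, rfl⟩ := mem_desBot.1 hc
    exact ⟨(i, j), mem_desPairs.2 ⟨hij, hσ⟩, rfl⟩

theorem card_desBot : #(desBot σ) = des σ := by
  rw [card_eq_sum_ones, sum_desBot, ← card_eq_sum_ones]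
  rfl

/-- In a `231`-avoiding permutation, the letters between the two letters of a descent all come
after it. -/
theorem v31_2_add_des (h : σ ∈ avoiders m ![2, 3, 1]) :
    v31_2 σ + des σ = ∑ c ∈ desTop σ, c.val - ∑ a ∈ desBot σ, a.val := by
  have h1 : v31_2 σ = ∑ p ∈ desPairs σ, #{k : Fin m | p.2 < k ∧ σ p.2 < σ k ∧ σ k < σ p.1} := by
    rw [v31_2, ← card_sigma]
    refine card_nbij' (fun p => ⟨(p.1, p.2.1), p.2.2⟩) (fun x => (x.1.1, x.1.2, x.2)) ?_ ?_ ?_ ?_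
    · rintro ⟨i, j, k⟩ hp
      simp only [coe_filter, Set.mem_ofPred_eq, mem_univ, true_and] at hp
      simp only [coe_sigma, Set.mem_sigma_iff, mem_coe, mem_desPairs, mem_filter, mem_univ,
        true_and]
      exact ⟨⟨hp.1, hp.2.2.1.trans hp.2.2.2⟩, hp.2⟩
    · rintro ⟨⟨i, j⟩, k⟩ hp
      simp only [coe_sigma, Set.mem_sigma_iff, mem_coe, mem_desPairs, mem_filter, mem_univ,
        true_and] at hp
      simp only [coe_filter, Set.mem_ofPred_eq, mem_univ, true_and]
      exact ⟨hp.1.1, hp.2⟩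
    · intro _ _; rfl
    · intro _ _; rfl
  -- The values strictly between bottom and top number one less than their difference; the missing
  -- unit, summed over descents, is `des σ`.
  have h2 : ∀ p ∈ desPairs σ,
      #{k : Fin m | p.2 < k ∧ σ p.2 < σ k ∧ σ k < σ p.1} + 1 + (σ p.2).val = (σ p.1).val := by
    rintro ⟨i, j⟩ hp
    rw [mem_desPairs] at hp
    simp only at hp ⊢
    have h3 : ({k : Fin m | j < k ∧ σ j < σ k ∧ σ k < σ i} : Finset (Fin m)).map σ.toEmbedding =
        Ioo (σ j) (σ i) := by
      ext x
      obtain ⟨k, rfl⟩ := σ.surjective x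
      simp only [mem_map_equiv, Equiv.symm_apply_apply, mem_filter, mem_univ, true_and, mem_Ioo,
        and_iff_right_iff_imp]
      rintro ⟨a1, a2⟩
      by_contra! hc
      have k1 : k ≠ j := by rintro rfl; exact lt_irrefl _ a1
      have k2 : k ≠ i := by rintro rfl; exact lt_irrefl _ a2
      exact mem_avoiders_231.1 h k i j (by omega) (by omega) a1 a2
    rw [← card_map σ.toEmbedding, h3, Fin.card_Ioo]
    have := hp.2
    omega
  have h3 : des σ = ∑ p ∈ desPairs σ, 1 := (card_eq_sum_ones _)
  have h4 := sum_congr rfl h2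
  rw [sum_add_distrib, sum_add_distrib, ← h1, ← h3, ← sum_desTop fun x => x.val,
    ← sum_desBot fun x => x.val] at h4
  omega

end

/-- The letter following the letter `c` in the word of `σ`. -/
def nextLetter {m : ℕ} (σ : Equiv.Perm (Fin m)) (c : Fin m) : Fin m :=
  if h : (σ⁻¹ c).val + 1 < m then σ ⟨(σ⁻¹ c).val + 1, h⟩ else c

/-- The letters are sorted by their keys: a letter of `V` comes right before its partner. -/
def sortKey {m : ℕ} (V : Finset (Fin m)) (d : Fin m → Fin m) (x : Fin m) : ℕ :=
  if x ∈ V then 2 * (d x).val else 2 * x.val + 1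

theorem strictMono_of_lt_next {m : ℕ} {f : Fin m → ℕ}
    (h : ∀ i j : Fin m, i.val + 1 = j.val → f i < f j) : StrictMono f := by
  cases m with
  | zero => exact fun i => i.elim0
  | succ m => exact Fin.strictMono_iff_lt_succ.2 fun i => h _ _ (by simp)

section

variable {m : ℕ} {σ : Equiv.Perm (Fin m)}

theorem nextLetter_apply {i j : Fin m} (hij : i.val + 1 = j.val) :
    nextLetter σ (σ i) = σ j := by
  have h : (σ⁻¹ (σ i)).val + 1 = j.val := by simpa using hij
  rw [nextLetter, dif_pos (h ▸ j.2)]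
  congr 1
  exact Fin.ext h

theorem disjoint_desBot_desTop (h : ldd σ = 0) : Disjoint (desBot σ) (desTop σ) := by
  rw [ldd_eq_zero_iff] at h
  rw [disjoint_left]
  intro x h1 h2
  obtain ⟨i, j, hij, hσ, rfl⟩ := mem_desBot.1 h1
  obtain ⟨j', k, hjk, hσ', he⟩ := mem_desTop.1 h2
  obtain rfl := σ.injective he
  exact h i j' k hij hjk hσ hσ'

/-- For crossing arcs with tops `b < c`, a 231 is formed by `b`, `c` and the bottom of `c` if the
descent of `b` comes first, and otherwise by the bottom of `c`, `b` and the bottom of `b`. -/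
theorem noncrossingMatching_nextLetter (h : σ ∈ avoiders m ![2, 3, 1]) :
    NoncrossingMatching (desBot σ) (desTop σ) (nextLetter σ) := by
  refine ⟨⟨?_, ?_, ?_⟩, ?_, ?_⟩
  · intro c hc
    obtain ⟨i, j, hij, hσ, rfl⟩ := mem_desTop.1 hc
    rw [nextLetter_apply hij]
    exact mem_desBot.2 ⟨i, j, hij, hσ, rfl⟩
  · intro b hb c hc hbc
    obtain ⟨i, j, hij, hσ, rfl⟩ := mem_desTop.1 hb
    obtain ⟨k, l, hkl, hσ', rfl⟩ := mem_desTop.1 hc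
    rw [nextLetter_apply hij, nextLetter_apply hkl] at hbc
    have := congrArg Fin.val (σ.injective hbc)
    congr 1
    omega
  · intro a ha
    obtain ⟨i, j, hij, hσ, rfl⟩ := mem_desBot.1 ha
    exact ⟨σ i, mem_desTop.2 ⟨i, j, hij, hσ, rfl⟩, nextLetter_apply hij⟩
  · intro c hc
    obtain ⟨i, j, hij, hσ, rfl⟩ := mem_desTop.1 hc
    rwa [nextLetter_apply hij]
  · intro b hb c hc
    obtain ⟨i, j, hij, hσ, rfl⟩ := mem_desTop.1 hb
    obtain ⟨k, l, hkl, hσ', rfl⟩ := mem_desTop.1 hc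
    rw [nextLetter_apply hij, nextLetter_apply hkl]
    intro h1 h2
    have hik : i ≠ k := by rintro rfl; exact lt_irrefl _ h2
    by_contra! hle
    have hjl : j ≠ l := by rintro rfl; omega
    have hlt : σ j < σ l := lt_of_le_of_ne hle fun e => hjl (σ.injective e)
    have hli : l ≠ i := by rintro rfl; exact lt_irrefl _ h1
    rw [mem_avoiders_231] at h
    rcases lt_or_gt_of_ne hik with hik | hik
    · exact h i k l hik (by omega) h1 h2
    · exact h l i j (by omega) (by omega) hlt h1

/-- At a descent with bottom `a` the keys are `2a` and `2a + 1`, because `a` is not itself a top. At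
an ascent into a top, avoiding 231 forces the first letter below the bottom of the coming descent.
-/
theorem strictMono_sortKey (h : σ ∈ avoiders m ![2, 3, 1]) (hl : ldd σ = 0) :
    StrictMono (sortKey (desTop σ) (nextLetter σ) ∘ σ) := by
  refine strictMono_of_lt_next fun i j hij => ?_
  simp only [Function.comp, sortKey]
  by_cases hi : σ i ∈ desTop σ
  · have hj : σ j ∉ desTop σ := by
      obtain ⟨i', j', hij', hσ, he⟩ := mem_desTop.1 hi
      obtain rfl := σ.injective he
      obtain rfl : j = j' := Fin.ext (hij.symm.trans hij')
      exact disjoint_left.1 (disjoint_desBot_desTop hl) (mem_desBot.2 ⟨_, _, hij, hσ, rfl⟩)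
    rw [if_pos hi, if_neg hj, nextLetter_apply hij]
    omega
  · have hlt : σ i < σ j := by
      by_contra! hle
      have hne : j ≠ i := by rintro rfl; omega
      exact hi (mem_desTop.2
        ⟨i, j, hij, lt_of_le_of_ne hle fun e => hne (σ.injective e), rfl⟩)
    rw [if_neg hi]
    by_cases hj : σ j ∈ desTop σ
    · obtain ⟨j', k, hjk, hσ, he⟩ := mem_desTop.1 hj
      obtain rfl := σ.injective he
      rw [if_pos hj, nextLetter_apply hjk]
      have hik : i ≠ k := by rintro rfl; omega
      have h1 : ¬ σ k < σ i := fun h' =>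
        mem_avoiders_231.1 h i j' k (by omega) (by omega) h' hlt
      have h2 : σ i < σ k := lt_of_le_of_ne (not_lt.1 h1) fun e => hik (σ.injective e)
      omega
    · rw [if_neg hj]
      omega

end

/-- The pair determines its noncrossing matching, hence the keys, hence the word as the letters
sorted by key. -/
theorem desPair_injOn {m k : ℕ} : Set.InjOn (fun σ : Equiv.Perm (Fin m) => (desBot σ, desTop σ))
    (tilde231 m k) := by
  intro σ hσ τ hτ h
  simp only [Prod.mk.injEq] at h
  obtain ⟨a1, -, l1⟩ := mem_filter.1 (mem_coe.1 hσ)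
  obtain ⟨a2, -, l2⟩ := mem_filter.1 (mem_coe.1 hτ)
  have hd := (noncrossingMatching_nextLetter a1).eqOn
    (h.1 ▸ h.2 ▸ noncrossingMatching_nextLetter a2)
  have hk : sortKey (desTop σ) (nextLetter σ) = sortKey (desTop τ) (nextLetter τ) := by
    ext x
    rw [sortKey, sortKey, ← h.2]
    by_cases hx : x ∈ desTop σ
    · rw [if_pos hx, if_pos hx, hd hx]
    · rw [if_neg hx, if_neg hx]
  have m1 := strictMono_sortKey a1 l1
  have m2 := strictMono_sortKey a2 l2
  rw [← hk] at m2
  have hinj : Function.Injective (sortKey (desTop σ) (nextLetter σ)) :=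
    (Function.Injective.of_comp_iff' _ σ.bijective).1 m1.injective
  have he := eqOn_of_strictMonoOn (s := Set.univ) (m1.strictMonoOn _) (m2.strictMonoOn _)
    (by rw [Set.image_univ, Set.image_univ, σ.surjective.range_comp, τ.surjective.range_comp])
  exact Equiv.ext fun x => hinj (he (Set.mem_univ x))

theorem desPair_surj {m : ℕ} {E V : Finset (Fin m)} (hp : (E, V) ∈ motzkinPairs m) :
    ∃ σ ∈ avoiders m ![2, 3, 1], ldd σ = 0 ∧ (desBot σ, desTop σ) = (E, V) := by
  obtain ⟨d, hd⟩ := exists_noncrossingMatching hp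
  have hdisj : Disjoint E V := (mem_motzkinPairs.1 hp).2
  have hV : ∀ x ∈ V, sortKey V d x = 2 * (d x).val := fun x hx => if_pos hx
  have hV' : ∀ x ∉ V, sortKey V d x = 2 * x.val + 1 := fun x hx => if_neg hx
  have hE : ∀ x ∈ V, sortKey V d (d x) = 2 * (d x).val + 1 := fun x hx =>
    hV' _ (disjoint_left.1 hdisj (hd.bijOn.mapsTo hx))
  have hle : ∀ x, sortKey V d x ≤ 2 * x.val + 1 := by
    intro x
    by_cases hx : x ∈ V
    · have := hd.lt x hx
      rw [hV x hx]
      omega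
    · rw [hV' x hx]
  have hinj : Function.Injective (sortKey V d) := by
    intro x y hxy
    by_cases hx : x ∈ V <;> by_cases hy : y ∈ V
    · rw [hV x hx, hV y hy] at hxy
      exact hd.bijOn.injOn hx hy (Fin.ext (by omega))
    · rw [hV x hx, hV' y hy] at hxy
      omega
    · rw [hV' x hx, hV y hy] at hxy
      omega
    · rw [hV' x hx, hV' y hy] at hxy
      exact Fin.ext (by omega)
  obtain ⟨σ, hσ⟩ : ∃ σ : Equiv.Perm (Fin m), StrictMono (sortKey V d ∘ σ) :=
    ⟨Tuple.sort (sortKey V d), (Tuple.monotone_sort _).strictMono_of_injective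
      (hinj.comp (Equiv.injective _))⟩
  have hlt : ∀ i j, i < j → sortKey V d (σ i) < sortKey V d (σ j) := fun i j hij => hσ hij
  have hlt' : ∀ i j, sortKey V d (σ i) < sortKey V d (σ j) → i < j := fun i j => hσ.lt_iff_lt.1
  -- The keys of `c ∈ V` and `d c` are the consecutive integers `2 * d c` and `2 * d c + 1`, so no
  -- letter fits between them.
  have next : ∀ i, σ i ∈ V → ∃ j : Fin m, i.val + 1 = j.val ∧ σ j = d (σ i) := by
    intro i hi
    obtain ⟨j, hj⟩ := σ.surjective (d (σ i))
    have hij : i < j := hlt' i j (by rw [hj, hV _ hi, hE _ hi]; omega)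
    refine ⟨j, ?_, hj⟩
    by_contra hne
    have h1 := hlt i ⟨i.val + 1, by omega⟩ (Fin.lt_def.2 (by simp))
    have h2 := hlt ⟨i.val + 1, by omega⟩ j (Fin.lt_def.2 (by simp only; omega))
    rw [hj, hE _ hi] at h2
    rw [hV _ hi] at h1
    omega
  -- Keys are at most `2x + 1`, with equality off `V`, so a letter off `V` never precedes a smaller
  -- one.
  have top : ∀ i j : Fin m, i.val + 1 = j.val → σ j < σ i → σ i ∈ V ∧ σ j = d (σ i) := by
    intro i j hij hji
    have hi : σ i ∈ V := by
      by_contra hi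
      have h1 := hlt i j (by omega)
      have h2 := hle (σ j)
      rw [hV' _ hi] at h1
      omega
    obtain ⟨j', hij', hj'⟩ := next i hi
    obtain rfl : j = j' := Fin.ext (hij.symm.trans hij')
    exact ⟨hi, hj'⟩
  have eV : desTop σ = V := by
    ext c
    rw [mem_desTop]
    constructor
    · rintro ⟨i, j, hij, hji, rfl⟩
      exact (top i j hij hji).1
    · intro hc
      obtain ⟨i, rfl⟩ := σ.surjective c
      obtain ⟨j, hij, hj⟩ := next i hc
      exact ⟨i, j, hij, hj ▸ hd.lt _ hc, rfl⟩
  have eE : desBot σ = E := by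
    ext a
    rw [mem_desBot]
    constructor
    · rintro ⟨i, j, hij, hji, rfl⟩
      rw [(top i j hij hji).2]
      exact hd.bijOn.mapsTo (top i j hij hji).1
    · intro ha
      obtain ⟨c, hc, rfl⟩ := hd.bijOn.surjOn ha
      obtain ⟨i, rfl⟩ := σ.surjective c
      obtain ⟨j, hij, hj⟩ := next i hc
      exact ⟨i, j, hij, hj ▸ hd.lt _ hc, hj⟩
  refine ⟨σ, mem_avoiders_231.2 fun i j k hij hjk h1 h2 => ?_, ?_, by rw [eE, eV]⟩
  -- In a 231 the first two letters precede a smaller one, so both lie in `V`. The key order gives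
  -- `d (σ i) < d (σ j)`, and noncrossing gives the opposite.
  · have f1 := hlt i j hij
    have f2 := hlt j k hjk
    have f3 := hle (σ k)
    have hi : σ i ∈ V := by
      by_contra hi
      rw [hV' _ hi] at f1
      omega
    have hj : σ j ∈ V := by
      by_contra hj
      rw [hV' _ hj] at f2
      omega
    rw [hV _ hi, hV _ hj] at f1
    rw [hV _ hj] at f2
    have := hd.noncrossing _ hi _ hj (by omega) h2
    omega
  · refine ldd_eq_zero_iff.2 fun i j k hij hjk h1 h2 => ?_
    refine disjoint_left.1 hdisj (?_ : σ j ∈ E) ?_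
    · exact eE ▸ mem_desBot.2 ⟨i, j, hij, h1, rfl⟩
    · exact eV ▸ mem_desTop.2 ⟨j, k, hjk, h2, rfl⟩

open scoped Classical in
theorem sum_tilde231 {M : Type*} [AddCommMonoid M] (m k : ℕ)
    (g : Finset (Fin m) × Finset (Fin m) → M) :
    ∑ σ ∈ tilde231 m k, g (desBot σ, desTop σ) = ∑ p ∈ motzkinPairs m with #p.1 = k, g p := by
  refine sum_nbij (fun σ => (desBot σ, desTop σ)) ?_ desPair_injOn ?_ fun _ _ => rfl
  · intro σ hσ
    obtain ⟨ha, hk, hl⟩ := mem_filter.1 hσ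
    exact mem_filter.2 ⟨mem_motzkinPairs.2 ⟨(noncrossingMatching_nextLetter ha).mem_ballotPairs,
      disjoint_desBot_desTop hl⟩, card_desBot.trans hk⟩
  · intro p hp
    obtain ⟨hp, hk⟩ := mem_filter.1 (mem_coe.1 hp)
    obtain ⟨σ, ha, hl, he⟩ := desPair_surj hp
    refine ⟨σ, mem_coe.2 (mem_filter.2 ⟨ha, ?_, hl⟩), he⟩
    rw [← card_desBot, ← hk]
    exact congrArg (fun p => #p.1) he

theorem gammaPoly_eq_231 (m k : ℕ) : gammaPoly m k =
    ∑ π ∈ tilde231 m k, (Polynomial.X : Polynomial ℕ) ^ (v31_2 π + des π) := by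
  classical
  rw [gammaPoly_eq, ← sum_tilde231]
  refine sum_congr rfl fun σ hσ => ?_
  rw [v31_2_add_des (mem_filter.1 hσ).1]

/-! ### Transfer to 132, 213 and 312 by reversal and complementation. -/

/-- The complement of the word of `σ`. -/
def complement {m : ℕ} (σ : Equiv.Perm (Fin m)) : Equiv.Perm (Fin m) := Fin.revPerm * σ

/-- The reverse of the word of `σ`. -/
def reverse {m : ℕ} (σ : Equiv.Perm (Fin m)) : Equiv.Perm (Fin m) := σ * Fin.revPerm

section

variable {m : ℕ} (σ : Equiv.Perm (Fin m))

theorem complement_apply (i : Fin m) : complement σ i = (σ i).rev := rfl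

theorem reverse_apply (i : Fin m) : reverse σ i = σ i.rev := rfl

theorem complement_complement : complement (complement σ) = σ := by
  ext i; simp [complement_apply]

theorem reverse_reverse : reverse (reverse σ) = σ := by
  ext i; simp [reverse_apply]

theorem asc_complement : asc (complement σ) = des σ := by
  simp only [asc, des, complement_apply, Fin.rev_lt_rev]

theorem des_complement : des (complement σ) = asc σ := by
  simp only [asc, des, complement_apply, Fin.rev_lt_rev]

theorem rda_complement : rda (complement σ) = 0 ↔ ldd σ = 0 := by
  simp only [rda_eq_zero_iff, ldd_eq_zero_iff, complement_apply, Fin.rev_lt_rev]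

theorem ldd_complement : ldd (complement σ) = 0 ↔ rda σ = 0 := by
  simp only [rda_eq_zero_iff, ldd_eq_zero_iff, complement_apply, Fin.rev_lt_rev]

theorem v13_2_complement : v13_2 (complement σ) = v31_2 σ := by
  simp only [v13_2, v31_2, complement_apply, Fin.rev_lt_rev]
  congr 1; ext p; simp only [mem_filter]; tauto

theorem v2_31_complement : v2_31 (complement σ) = v2_13 σ := by
  simp only [v2_31, v2_13, complement_apply, Fin.rev_lt_rev]
  congr 1; ext p; simp only [mem_filter]; tauto

theorem asc_reverse : asc (reverse σ) = des σ := by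
  refine card_nbij' (fun p => (p.2.rev, p.1.rev)) (fun p => (p.2.rev, p.1.rev)) ?_ ?_ ?_ ?_
  · rintro ⟨i, j⟩ hp
    simp only [mem_coe, mem_filter, mem_univ, true_and] at hp ⊢
    simp only [reverse_apply] at hp ⊢
    exact ⟨by simp only [Fin.val_rev]; omega, hp.2⟩
  · rintro ⟨i, j⟩ hp
    simp only [mem_coe, mem_filter, mem_univ, true_and] at hp ⊢
    simp only [reverse_apply, Fin.rev_rev] at hp ⊢
    exact ⟨by simp only [Fin.val_rev]; omega, hp.2⟩
  · intro p _; simp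
  · intro p _; simp

theorem v2_13_reverse : v2_13 (reverse σ) = v31_2 σ := by
  refine card_nbij' (fun p => (p.2.1.rev, p.1.rev, p.2.2.rev))
    (fun p => (p.2.1.rev, p.1.rev, p.2.2.rev)) ?_ ?_ ?_ ?_
  · rintro ⟨i, j, k⟩ hp
    simp only [mem_coe, mem_filter, mem_univ, true_and] at hp ⊢
    simp only [reverse_apply, Fin.rev_lt_rev] at hp ⊢
    exact ⟨by simp only [Fin.val_rev]; omega, hp.2⟩
  · rintro ⟨i, j, k⟩ hp
    simp only [mem_coe, mem_filter, mem_univ, true_and] at hp ⊢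
    simp only [reverse_apply, Fin.rev_rev, Fin.rev_lt_rev] at hp ⊢
    exact ⟨by simp only [Fin.val_rev]; omega, hp.2⟩
  · intro p _; simp
  · intro p _; simp

theorem rda_reverse : rda (reverse σ) = 0 ↔ ldd σ = 0 := by
  simp only [rda_eq_zero_iff, ldd_eq_zero_iff, reverse_apply]
  constructor
  · intro h i j k hij hjk h1 h2
    exact h k.rev j.rev i.rev (by simp only [Fin.val_rev]; omega)
      (by simp only [Fin.val_rev]; omega) (by simpa using h2) (by simpa using h1)
  · intro h i j k hij hjk h1 h2
    exact h k.rev j.rev i.rev (by simp only [Fin.val_rev]; omega)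
      (by simp only [Fin.val_rev]; omega) h2 h1

theorem reverse_mem_avoiders_132 :
    reverse σ ∈ avoiders m ![1, 3, 2] ↔ σ ∈ avoiders m ![2, 3, 1] := by
  rw [mem_avoiders_132, mem_avoiders_231]
  simp only [reverse_apply]
  constructor
  · intro h i j k hij hjk h1 h2
    exact h k.rev j.rev i.rev (Fin.rev_lt_rev.2 hjk) (Fin.rev_lt_rev.2 hij)
      (by simpa using h1) (by simpa using h2)
  · intro h i j k hij hjk h1 h2
    exact h k.rev j.rev i.rev (Fin.rev_lt_rev.2 hjk) (Fin.rev_lt_rev.2 hij) h1 h2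

theorem complement_mem_avoiders_213 :
    complement σ ∈ avoiders m ![2, 1, 3] ↔ σ ∈ avoiders m ![2, 3, 1] := by
  rw [mem_avoiders_213, mem_avoiders_231]
  simp only [complement_apply, Fin.rev_lt_rev]
  grind

theorem complement_mem_avoiders_312 :
    complement σ ∈ avoiders m ![3, 1, 2] ↔ σ ∈ avoiders m ![1, 3, 2] := by
  rw [mem_avoiders_312, mem_avoiders_132]
  simp only [complement_apply, Fin.rev_lt_rev]
  grind

end

theorem gammaPoly_eq_132 (m k : ℕ) : gammaPoly m k =
    ∑ π ∈ tilde132 m k, (Polynomial.X : Polynomial ℕ) ^ (v2_13 π + asc π) := by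
  rw [gammaPoly_eq_231]
  have h : ∀ σ : Equiv.Perm (Fin m), reverse σ ∈ tilde132 m k ↔ σ ∈ tilde231 m k := fun σ => by
    simp only [tilde132, tilde231, mem_filter, reverse_mem_avoiders_132, asc_reverse, rda_reverse]
  refine sum_nbij' reverse reverse (fun σ => (h σ).2) (fun σ hσ => ?_)
    (fun σ _ => reverse_reverse σ) (fun σ _ => reverse_reverse σ) fun σ _ => ?_
  · rwa [← h, reverse_reverse]
  · rw [v2_13_reverse, asc_reverse]

theorem gammaPoly_eq_213 (m k : ℕ) : gammaPoly m k =
    ∑ π ∈ tilde213 m k, (Polynomial.X : Polynomial ℕ) ^ (v13_2 π + asc π) := by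
  rw [gammaPoly_eq_231]
  have h : ∀ σ : Equiv.Perm (Fin m), complement σ ∈ tilde213 m k ↔ σ ∈ tilde231 m k := fun σ => by
    simp only [tilde213, tilde231, mem_filter, complement_mem_avoiders_213, asc_complement,
      rda_complement]
  refine sum_nbij' complement complement (fun σ => (h σ).2) (fun σ hσ => ?_)
    (fun σ _ => complement_complement σ) (fun σ _ => complement_complement σ) fun σ _ => ?_
  · rwa [← h, complement_complement]
  · rw [v13_2_complement, asc_complement]

/-- The pattern 312 is the reverse-complement of 231, so the sum over 132 serves as the intermediate
stage. -/
theorem gammaPoly_eq_312 (m k : ℕ) : gammaPoly m k =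
    ∑ π ∈ tilde312 m k, (Polynomial.X : Polynomial ℕ) ^ (v2_31 π + des π) := by
  rw [gammaPoly_eq_132]
  have h : ∀ σ : Equiv.Perm (Fin m), complement σ ∈ tilde312 m k ↔ σ ∈ tilde132 m k := fun σ => by
    simp only [tilde312, tilde132, mem_filter, complement_mem_avoiders_312, des_complement,
      ldd_complement]
  refine sum_nbij' complement complement (fun σ => (h σ).2) (fun σ hσ => ?_)
    (fun σ _ => complement_complement σ) (fun σ _ => complement_complement σ) fun σ _ => ?_
  · rwa [← h, complement_complement]
  · rw [v2_31_complement, des_complement]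

end PermStat

theorem mainTheorem8 (n : ℕ) (hn : 1 ≤ n) :
    (∀ (K : Type*) [Field K] (t q : K), q ≠ 0 →
      PermStat.qNarayana n (t / q) q 1 =
          ∑ σ ∈ PermStat.avoiders n ![3, 2, 1],
            t ^ PermStat.exc σ * q ^ ((PermStat.inv σ : ℤ) - (PermStat.exc σ : ℤ)) ∧
      PermStat.qNarayana n (t / q) q 1 =
          ∑ k ∈ Finset.range ((n - 1) / 2 + 1),
            Polynomial.aeval q (PermStat.gammaPoly (n - 1) k) * t ^ k *
              (1 + t) ^ (n - 1 - 2 * k)) ∧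
    ∀ k : ℕ,
      PermStat.gammaPoly (n - 1) k =
          ∑ π ∈ PermStat.tilde231 (n - 1) k,
            (Polynomial.X : Polynomial ℕ) ^ (PermStat.v31_2 π + PermStat.des π) ∧
      PermStat.gammaPoly (n - 1) k =
          ∑ π ∈ PermStat.tilde312 (n - 1) k,
            (Polynomial.X : Polynomial ℕ) ^ (PermStat.v2_31 π + PermStat.des π) ∧
      PermStat.gammaPoly (n - 1) k =
          ∑ π ∈ PermStat.tilde132 (n - 1) k,
            (Polynomial.X : Polynomial ℕ) ^ (PermStat.v2_13 π + PermStat.asc π) ∧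
      PermStat.gammaPoly (n - 1) k =
          ∑ π ∈ PermStat.tilde213 (n - 1) k,
            (Polynomial.X : Polynomial ℕ) ^ (PermStat.v13_2 π + PermStat.asc π) := by
  obtain ⟨m, rfl⟩ := Nat.exists_eq_add_of_le' hn
  rw [Nat.add_sub_cancel]
  exact ⟨fun K _ t q hq => ⟨PermStat.qNarayana_div hq _, PermStat.qNarayana_succ hq m⟩,
    fun k => ⟨PermStat.gammaPoly_eq_231 m k, PermStat.gammaPoly_eq_312 m k,
      PermStat.gammaPoly_eq_132 m k, PermStat.gammaPoly_eq_213 m k⟩⟩
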